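/- Let $\Gamma$ be a finite simplicial graph with vertex set $V$, and let $A_\Gamma=\langle V \mid [u,v]=1 \text{ whenever } u,v \text{ are adjacent in } \Gamma\rangle$ be the right-angled Artin group it defines. A palindrome is a word $u_1\dots u_k$ on $V^{\pm1}$ that is identical, as a word, with its reverse $u_k\dots u_1$. An automorphism $\alpha\in\mathrm{Aut}(A_\Gamma)$ is called palindromic if, for each $v\in V$, $\alpha(v)$ can be represented by a palindrome; it is called pure palindromic if, moreover, for each $v\in V$, $\alpha(v)$ can be represented by a palindrome of odd length whose middle letter is $v$ or $v^{-1}$. Each graph automorphism $\phi\in\mathrm{Aut}(\Gamma)$ induces an automorphism of $A_\Gamma$ with $v\mapsto\phi(v)$ for $v\in V$, called a diagram automorphism. Let $\alpha\in\mathrm{Aut}(A_\Gamma)$ be palindromic. Then $\alpha$ can be expressed as $\alpha=\delta\gamma$ (that is, $\alpha(x)=\delta(\gamma(x))$ for all $x \in A_\Gamma$), where $\delta$ is a diagram automorphism and $\gamma$ is a pure palindromic automorphism. Moreover, $\delta$ can be chosen so that, for each $v\in V$, every palindrome representing $\alpha(v)$ has odd length and middle letter $\delta(v)$ or $\delta(v)^{-1}$.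 -/

import Mathlib

namespace RAAGPal

variable {V : Type*}

/-- The defining relators of the right-angled Artin group: one commutator `[u, v]` for each pair of
adjacent vertices. -/
def raagRels (G : SimpleGraph V) : Set (FreeGroup V) :=
  {r | ∃ u v : V, G.Adj u v ∧
    r = FreeGroup.of u * FreeGroup.of v * (FreeGroup.of u)⁻¹ * (FreeGroup.of v)⁻¹}

/-- The right-angled Artin group of `G`. -/
abbrev RAAG (G : SimpleGraph V) : Type _ := PresentedGroup (raagRels G)

/-- The generator of the right-angled Artin group given by a vertex. -/
def gen (G : SimpleGraph V) (v : V) : RAAG G := PresentedGroup.of v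

/-- The element represented by a word on `V^{±1}`; the letter `(v, true)` is `v` and
`(v, false)` is `v⁻¹`. Words need not be reduced. -/
def wordVal (G : SimpleGraph V) (w : List (V × Bool)) : RAAG G :=
  PresentedGroup.mk (raagRels G) (FreeGroup.mk w)

/-- `w` is a palindrome: `w` and its reverse are identical as words. -/
def IsPalindromeWord (w : List (V × Bool)) : Prop := w.reverse = w

/-- `w` has odd length and its middle letter is `a`. -/
def IsMiddleLetter (a : V × Bool) (w : List (V × Bool)) : Prop :=
  ∃ p q : List (V × Bool), p.length = q.length ∧ w = p ++ a :: q

/-- The set of palindromic automorphisms: every vertex is sent to an element that is represented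
by some palindrome. -/
def palindromicAuts (G : SimpleGraph V) : Set (MulAut (RAAG G)) :=
  {α | ∀ v : V, ∃ w : List (V × Bool), IsPalindromeWord w ∧ wordVal G w = α (gen G v)}

/-- The set of pure palindromic automorphisms: palindromic automorphisms such that the image of
each vertex `v` is represented by a palindrome with middle letter `v` or `v⁻¹`. -/
def purePalindromicAuts (G : SimpleGraph V) : Set (MulAut (RAAG G)) :=
  {α | α ∈ palindromicAuts G ∧ ∀ v : V, ∃ w : List (V × Bool), IsPalindromeWord w ∧
    (IsMiddleLetter (v, true) w ∨ IsMiddleLetter (v, false) w) ∧ wordVal G w = α (gen G v)}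

theorem gen_comm (G : SimpleGraph V) {u v : V} (h : G.Adj u v) :
    gen G u * gen G v * (gen G u)⁻¹ * (gen G v)⁻¹ = 1 :=
  PresentedGroup.one_of_mem (rels := raagRels G) ⟨u, v, h, rfl⟩

theorem diagramHom_aux (G : SimpleGraph V) (φ : G ≃g G) :
    ∀ r ∈ raagRels G, FreeGroup.lift (fun v => gen G (φ v)) r = 1 := by
  rintro r ⟨u, v, h, rfl⟩
  simpa only [map_mul, map_inv, FreeGroup.lift_apply_of] using
    gen_comm G (φ.map_adj_iff.2 h)

/-- The endomorphism `v ↦ φ v` induced by a graph automorphism `φ`. -/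
def diagramHom (G : SimpleGraph V) (φ : G ≃g G) : RAAG G →* RAAG G :=
  PresentedGroup.toGroup (diagramHom_aux G φ)

theorem diagramHom_gen (G : SimpleGraph V) (φ : G ≃g G) (v : V) :
    diagramHom G φ (gen G v) = gen G (φ v) :=
  PresentedGroup.toGroup.of _

theorem diagramHom_comp (G : SimpleGraph V) (φ ψ : G ≃g G) (h : ∀ v, φ (ψ v) = v) :
    (diagramHom G φ).comp (diagramHom G ψ) = MonoidHom.id _ := by
  refine PresentedGroup.ext fun v => ?_
  change diagramHom G φ (diagramHom G ψ (gen G v)) = gen G v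
  rw [diagramHom_gen, diagramHom_gen, h]

/-- The diagram automorphism `v ↦ φ v` induced by a graph automorphism `φ`. -/
def diagramAut (G : SimpleGraph V) (φ : G ≃g G) : MulAut (RAAG G) :=
  MonoidHom.toMulEquiv (diagramHom G φ) (diagramHom G φ.symm)
    (diagramHom_comp G φ.symm φ φ.symm_apply_apply)
    (diagramHom_comp G φ φ.symm φ.apply_symm_apply)

theorem diagramAut_gen (G : SimpleGraph V) (φ : G ≃g G) (v : V) :
    diagramAut G φ (gen G v) = gen G (φ v) :=
  diagramHom_gen G φ v

end RAAGPal

namespace RAAGPal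

section

variable {V : Type*} {G : SimpleGraph V}

/-! A homomorphism to the group of order two kills every even palindrome and sees only the middle
letter of an odd one. As `α` is invertible, `α v` survives in some such homomorphism, so its
palindromes are odd, and its class modulo two fixes their middle vertex `m v`. Pulling parities back
along `α⁻¹` shows that `m` is injective. If `m u`, `m v` were distinct and nonadjacent, a map to the
dihedral group of order eight would separate the commuting `α u`, `α v` (`not_commute_of_parity`).
So, `V` being finite, `m` is a graph automorphism, and undoing it makes `α` pure. -/

theorem exists_middleLetter_or_even {w : List (V × Bool)} (hw : IsPalindromeWord w) :
    (∃ p, w = p ++ p.reverse) ∨ ∃ p a, w = p ++ a :: p.reverse := by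
  have hw' : w.Palindrome := List.Palindrome.of_reverse_eq hw
  induction hw' with
  | nil => exact Or.inl ⟨[], rfl⟩
  | singleton a => exact Or.inr ⟨[], a, rfl⟩
  | cons_concat x h ih =>
    rcases ih h.reverse_eq with ⟨p, rfl⟩ | ⟨p, a, rfl⟩
    · exact Or.inl ⟨x :: p, by simp⟩
    · exact Or.inr ⟨x :: p, a, by simp⟩

theorem wordVal_append (w₁ w₂ : List (V × Bool)) :
    wordVal G (w₁ ++ w₂) = wordVal G w₁ * wordVal G w₂ := by
  simp only [wordVal, ← FreeGroup.mul_mk, map_mul]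

theorem wordVal_singleton_true (v : V) : wordVal G [(v, true)] = gen G v := rfl

theorem wordVal_singleton_false (v : V) : wordVal G [(v, false)] = (gen G v)⁻¹ := rfl

theorem wordVal_cons (a : V × Bool) (w : List (V × Bool)) :
    wordVal G (a :: w) = wordVal G [a] * wordVal G w :=
  wordVal_append [a] w

theorem wordVal_nil : wordVal G ([] : List (V × Bool)) = 1 := rfl

theorem map_diagramAut_wordVal (φ : G ≃g G) (w : List (V × Bool)) :
    diagramAut G φ (wordVal G w) = wordVal G (w.map (Prod.map φ id)) := by
  induction w with
  | nil => simp [wordVal_nil]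
  | cons a w ih =>
    obtain ⟨v, b⟩ := a
    rw [List.map_cons, wordVal_cons, map_mul, ih, wordVal_cons (Prod.map φ id (v, b))]
    cases b <;>
      simp [wordVal_singleton_true, wordVal_singleton_false, diagramAut_gen]

/-! ### Palindromes modulo two -/

theorem mul_self_eq_one_of_zmod_two (x : Multiplicative (ZMod 2)) : x * x = 1 := by
  revert x; decide

theorem inv_eq_self_of_zmod_two (x : Multiplicative (ZMod 2)) : x⁻¹ = x := by
  revert x; decide

theorem hom_wordVal_reverse (g : RAAG G →* Multiplicative (ZMod 2)) (w : List (V × Bool)) :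
    g (wordVal G w.reverse) = g (wordVal G w) := by
  induction w with
  | nil => rfl
  | cons a w ih =>
    rw [List.reverse_cons, wordVal_append, wordVal_cons a w, map_mul, map_mul, ih, mul_comm]

theorem hom_wordVal_even (g : RAAG G →* Multiplicative (ZMod 2)) (p : List (V × Bool)) :
    g (wordVal G (p ++ p.reverse)) = 1 := by
  rw [wordVal_append, map_mul, hom_wordVal_reverse, mul_self_eq_one_of_zmod_two]

/-- A homomorphism to the group of order two sees only the middle letter of a palindrome. -/
theorem hom_wordVal_odd (g : RAAG G →* Multiplicative (ZMod 2)) (p : List (V × Bool))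
    (a : V × Bool) : g (wordVal G (p ++ a :: p.reverse)) = g (gen G a.1) := by
  have ha : g (wordVal G [a]) = g (gen G a.1) := by
    obtain ⟨v, b⟩ := a
    cases b
    · rw [wordVal_singleton_false, map_inv, inv_eq_self_of_zmod_two]
    · rfl
  rw [wordVal_append, wordVal_cons, map_mul, map_mul, hom_wordVal_reverse, ha,
    mul_left_comm, mul_self_eq_one_of_zmod_two, mul_one]

/-! ### Parities and dihedral quotients -/

/-- The homomorphism from the right-angled Artin group given by images of the generators that
commute along edges. -/
def liftHom {H : Type*} [Group H] (f : V → H) (hf : ∀ u v, G.Adj u v → Commute (f u) (f v)) :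
    RAAG G →* H :=
  PresentedGroup.toGroup (rels := raagRels G) (f := f) (by
    rintro r ⟨u, v, h, rfl⟩
    simp only [map_mul, map_inv, FreeGroup.lift_apply_of]
    rw [(hf u v h).eq, mul_inv_cancel_right, mul_inv_cancel])

theorem liftHom_gen {H : Type*} [Group H] (f : V → H)
    (hf : ∀ u v, G.Adj u v → Commute (f u) (f v)) (v : V) : liftHom f hf (gen G v) = f v :=
  PresentedGroup.toGroup.of _

open Classical in
/-- The exponent sum of the vertex `x` modulo two. -/
noncomputable def parity (G : SimpleGraph V) (x : V) : RAAG G →* Multiplicative (ZMod 2) :=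
  liftHom (fun v => if v = x then Multiplicative.ofAdd 1 else 1) fun _ _ _ => Commute.all _ _

open Classical in
theorem parity_gen (x v : V) :
    parity G x (gen G v) = if v = x then Multiplicative.ofAdd 1 else 1 :=
  liftHom_gen _ _ v

theorem parity_gen_self (x : V) : parity G x (gen G x) ≠ 1 := by
  rw [parity_gen, if_pos rfl]; decide

theorem parity_gen_of_ne {x v : V} (h : v ≠ x) : parity G x (gen G v) = 1 := by
  rw [parity_gen, if_neg h]

/-- The homomorphism from the dihedral group of order eight that detects reflections. -/
def dihedralRefl : DihedralGroup 4 →* Multiplicative (ZMod 2) where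
  toFun
    | .r _ => 1
    | .sr _ => Multiplicative.ofAdd 1
  map_one' := rfl
  map_mul' := by decide

/-- The homomorphism from the dihedral group of order eight that reads the rotation parameter
modulo two. -/
def dihedralRot : DihedralGroup 4 →* Multiplicative (ZMod 2) where
  toFun
    | .r i => Multiplicative.ofAdd (i.val : ZMod 2)
    | .sr i => Multiplicative.ofAdd (i.val : ZMod 2)
  map_one' := rfl
  map_mul' := by decide

/-- Here `x` is a reflection and `y` is `r 1` or `r 3`; conjugation by `x` inverts `y`, which has
order four. -/
theorem dihedral_not_commute (x y : DihedralGroup 4) (hx : dihedralRefl x ≠ 1)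
    (hx' : dihedralRot x = 1) (hy : dihedralRefl y = 1) (hy' : dihedralRot y ≠ 1) :
    x * y ≠ y * x := by
  have key : ∀ x y : DihedralGroup 4, ¬ (dihedralRefl x ≠ 1 ∧ dihedralRot x = 1 ∧
      dihedralRefl y = 1 ∧ dihedralRot y ≠ 1 ∧ x * y = y * x) := by decide
  exact fun h => key x y ⟨hx, hx', hy, hy', h⟩

/-- Elements whose exponent sums modulo two agree with those of two distinct nonadjacent vertices
do not commute. -/
theorem not_commute_of_parity {a b : V} (hab : a ≠ b) (hadj : ¬ G.Adj a b) {x y : RAAG G}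
    (hxa : parity G a x ≠ 1) (hxb : parity G b x = 1)
    (hya : parity G a y = 1) (hyb : parity G b y ≠ 1) : ¬ Commute x y := by
  classical
  -- These images make `dihedralRefl` and `dihedralRot` restrict to the parities of `a` and `b`.
  let f : V → DihedralGroup 4 := fun v => if v = a then .sr 0 else if v = b then .r 1 else 1
  have hf : ∀ u v, G.Adj u v → Commute (f u) (f v) := by
    intro u v h
    have hb : ∀ v, v ≠ a → v ≠ b → f v = 1 := fun v h₁ h₂ => by simp [f, h₁, h₂]
    by_cases hu : u = a ∨ u = b
    · by_cases hv : v = a ∨ v = b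
      · rcases hu with rfl | rfl <;> rcases hv with rfl | rfl
        · exact Commute.refl _
        · exact absurd h hadj
        · exact absurd h.symm hadj
        · exact Commute.refl _
      · rw [not_or] at hv
        rw [hb v hv.1 hv.2]
        exact Commute.one_right _
    · rw [not_or] at hu
      rw [hb u hu.1 hu.2]
      exact Commute.one_left _
  have h₁ : dihedralRefl.comp (liftHom f hf) = parity G a := by
    refine PresentedGroup.ext fun v => ?_
    change dihedralRefl (liftHom f hf (gen G v)) = parity G a (gen G v)
    rw [liftHom_gen, parity_gen]
    dsimp only [f]
    split_ifs <;> rfl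
  have h₂ : dihedralRot.comp (liftHom f hf) = parity G b := by
    refine PresentedGroup.ext fun v => ?_
    change dihedralRot (liftHom f hf (gen G v)) = parity G b (gen G v)
    rw [liftHom_gen, parity_gen]
    dsimp only [f]
    split_ifs with h₃ h₄
    · exact absurd (h₃.symm.trans h₄) hab
    all_goals rfl
  intro hc
  refine dihedral_not_commute (liftHom f hf x) (liftHom f hf y) ?_ ?_ ?_ ?_
    (hc.map (liftHom f hf)).eq
  · rwa [← h₁] at hxa
  · rwa [← h₂] at hxb
  · rwa [← h₁] at hya
  · rwa [← h₂] at hyb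

/-! ### The induced graph automorphism -/

/-- A palindrome representing the image of a vertex under an automorphism has odd length. -/
theorem exists_eq_of_palindrome (α : MulAut (RAAG G)) {v : V} {w : List (V × Bool)}
    (hw : IsPalindromeWord w) (h : wordVal G w = α (gen G v)) :
    ∃ p a, w = p ++ a :: p.reverse := by
  refine (exists_middleLetter_or_even hw).resolve_left ?_
  rintro ⟨p, rfl⟩
  -- Parity of `v` pulled back along `α⁻¹` is nontrivial on `α v`.
  have := hom_wordVal_even ((parity G v).comp (α⁻¹ : MulAut (RAAG G)).toMonoidHom) p
  rw [h] at this
  refine parity_gen_self (G := G) v ?_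
  simpa using this

/-- Stating this through homomorphisms frees `x` from the choice of palindrome. -/
theorem exists_hom_gen_eq {α : MulAut (RAAG G)} (hα : α ∈ palindromicAuts G) (v : V) :
    ∃ x : V, ∀ g : RAAG G →* Multiplicative (ZMod 2), g (α (gen G v)) = g (gen G x) := by
  obtain ⟨w, hw, h⟩ := hα v
  obtain ⟨p, a, rfl⟩ := exists_eq_of_palindrome α hw h
  exact ⟨a.1, fun g => by rw [← h, hom_wordVal_odd]⟩

/-- An injective adjacency-preserving self-map of a finite graph is an automorphism. -/
theorem exists_iso_of_injective [Finite V] {m : V → V} (hm : Function.Injective m)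
    (hadj : ∀ u v, G.Adj u v → G.Adj (m u) (m v)) : ∃ φ : G ≃g G, ∀ v, φ v = m v := by
  let σ : Equiv.Perm V := Equiv.ofBijective m (Finite.injective_iff_bijective.1 hm)
  have hpow : ∀ (n : ℕ) (u v : V), G.Adj u v → G.Adj ((σ ^ n) u) ((σ ^ n) v) := by
    intro n
    induction n with
    | zero => exact fun u v h => h
    | succ n ih =>
      intro u v h
      rw [pow_succ, Equiv.Perm.mul_apply, Equiv.Perm.mul_apply]
      exact ih _ _ (hadj _ _ h)
  refine ⟨⟨σ, fun {u v} => ⟨fun h => ?_, hadj u v⟩⟩, fun v => rfl⟩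
  -- The inverse of `σ` is a nonnegative power of `σ`, so it preserves edges too.
  have hσ : σ ^ (orderOf σ - 1) * σ = 1 := by
    rw [← pow_succ, Nat.sub_add_cancel (orderOf_pos σ), pow_orderOf_eq_one]
  have := hpow (orderOf σ - 1) _ _ h
  rwa [← Equiv.Perm.mul_apply, ← Equiv.Perm.mul_apply, hσ] at this

theorem exists_iso_hom_gen_eq [Finite V] {α : MulAut (RAAG G)} (hα : α ∈ palindromicAuts G) :
    ∃ φ : G ≃g G, ∀ (v : V) (g : RAAG G →* Multiplicative (ZMod 2)),
      g (α (gen G v)) = g (gen G (φ v)) := by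
  choose m hm using exists_hom_gen_eq hα
  have hinj : Function.Injective m := by
    intro u v huv
    by_contra hne
    -- This `g` separates `α u` from `α v`, hence `m u` from `m v`.
    let g := (parity G u).comp (α⁻¹ : MulAut (RAAG G)).toMonoidHom
    have hg : ∀ x, g (α x) = parity G u x := fun x => by simp [g]
    refine parity_gen_self (G := G) u ?_
    rw [← hg, hm, huv, ← hm, hg, parity_gen_of_ne (Ne.symm hne)]
  have hadj : ∀ u v, G.Adj u v → G.Adj (m u) (m v) := by
    intro u v h
    by_contra hn
    have hne : m u ≠ m v := hinj.ne h.ne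
    have hc : Commute (gen G u) (gen G v) := by
      have := gen_comm G h
      rwa [mul_inv_eq_one, mul_inv_eq_iff_eq_mul] at this
    refine not_commute_of_parity hne hn ?_ ?_ ?_ ?_ (hc.map α)
    · rw [hm]; exact parity_gen_self _
    · rw [hm]; exact parity_gen_of_ne hne
    · rw [hm]; exact parity_gen_of_ne hne.symm
    · rw [hm]; exact parity_gen_self _
  obtain ⟨φ, hφ⟩ := exists_iso_of_injective hinj hadj
  exact ⟨φ, fun v g => by rw [hφ, hm]⟩

theorem isMiddleLetter_of_palindrome {α : MulAut (RAAG G)} {v y : V}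
    (hy : ∀ g : RAAG G →* Multiplicative (ZMod 2), g (α (gen G v)) = g (gen G y))
    {w : List (V × Bool)} (hw : IsPalindromeWord w) (h : wordVal G w = α (gen G v)) :
    IsMiddleLetter (y, true) w ∨ IsMiddleLetter (y, false) w := by
  obtain ⟨p, ⟨x, b⟩, rfl⟩ := exists_eq_of_palindrome α hw h
  obtain rfl : x = y := by
    by_contra hne
    refine parity_gen_self (G := G) y ?_
    rw [← hy, ← h, hom_wordVal_odd, parity_gen_of_ne hne]
  cases b
  · exact Or.inr ⟨p, p.reverse, by simp, rfl⟩
  · exact Or.inl ⟨p, p.reverse, by simp, rfl⟩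

theorem IsPalindromeWord.map {w : List (V × Bool)} (hw : IsPalindromeWord w)
    (f : V × Bool → V × Bool) : IsPalindromeWord (w.map f) := by
  rw [IsPalindromeWord, ← List.map_reverse, hw]

theorem IsMiddleLetter.map {a : V × Bool} {w : List (V × Bool)} (h : IsMiddleLetter a w)
    (f : V × Bool → V × Bool) : IsMiddleLetter (f a) (w.map f) := by
  obtain ⟨p, q, hpq, rfl⟩ := h
  exact ⟨p.map f, q.map f, by simp [hpq], by simp⟩

theorem diagramAut_inv (φ : G ≃g G) : (diagramAut G φ)⁻¹ = diagramAut G φ.symm := rfl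

end

end RAAGPal

theorem proposition3p4 {V : Type*} [Finite V] (G : SimpleGraph V)
    (α : MulAut (RAAGPal.RAAG G)) (hα : α ∈ RAAGPal.palindromicAuts G) :
    ∃ φ : G ≃g G, ∃ γ ∈ RAAGPal.purePalindromicAuts G,
      α = RAAGPal.diagramAut G φ * γ ∧
      ∀ (v : V) (w : List (V × Bool)), RAAGPal.IsPalindromeWord w →
        RAAGPal.wordVal G w = α (RAAGPal.gen G v) →
        RAAGPal.IsMiddleLetter (φ v, true) w ∨ RAAGPal.IsMiddleLetter (φ v, false) w := by
  obtain ⟨φ, hφ⟩ := RAAGPal.exists_iso_hom_gen_eq hα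
  have hmid : ∀ (v : V) (w : List (V × Bool)), RAAGPal.IsPalindromeWord w →
      RAAGPal.wordVal G w = α (RAAGPal.gen G v) →
      RAAGPal.IsMiddleLetter (φ v, true) w ∨ RAAGPal.IsMiddleLetter (φ v, false) w :=
    fun v w hw h => RAAGPal.isMiddleLetter_of_palindrome (hφ v) hw h
  have hpure : ∀ v : V, ∃ w : List (V × Bool), RAAGPal.IsPalindromeWord w ∧
      (RAAGPal.IsMiddleLetter (v, true) w ∨ RAAGPal.IsMiddleLetter (v, false) w) ∧
      RAAGPal.wordVal G w = ((RAAGPal.diagramAut G φ)⁻¹ * α) (RAAGPal.gen G v) := by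
    intro v
    obtain ⟨w, hw, h⟩ := hα v
    -- Relabelling by `φ.symm` keeps palindromes and moves the middle vertex from `φ v` to `v`.
    refine ⟨w.map (Prod.map φ.symm id), hw.map _, ?_, ?_⟩
    · refine (hmid v w hw h).imp (fun h => ?_) fun h => ?_ <;>
        simpa using h.map (Prod.map φ.symm id)
    · rw [MulAut.mul_apply, ← h, RAAGPal.diagramAut_inv, RAAGPal.map_diagramAut_wordVal]
  refine ⟨φ, (RAAGPal.diagramAut G φ)⁻¹ * α, ⟨fun v => ?_, hpure⟩,
    (mul_inv_cancel_left _ _).symm, hmid⟩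
  obtain ⟨w, hw, -, h⟩ := hpure v
  exact ⟨w, hw, h⟩
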